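/- Notation. For a complex matrix $M$, $\|M\|_2$ is the spectral norm and $\|M\|_{2,\infty}$ is the largest Euclidean norm of a row of $M$. For a norm $\|\cdot\|_*$, $B\in\mathbf{C}^{\ell\times\ell}$ and $C\in\mathbf{C}^{m\times m}$ put $\mathsf{sep}_*(B,C)=\inf\{\|ZB-CZ\|_* : Z\in\mathbf{C}^{m\times\ell},\ \|Z\|_*=1\}$; and for $W\in\mathbf{C}^{m\times k}$ let $\mathsf{sep}_{*,W}(B,C)$ be the same infimum restricted to those $Z$ whose columns lie in the range of $W$. $\mathbf{O}^r$ is the group of real orthogonal $r\times r$ matrices. Theorem 4.1. Let $1\le r<n$ and let $A\in\mathbf{C}^{n\times n}$ (in particular, any $A\in\mathbf{R}^{n\times n}$) have the Schur form \[ A=\begin{bmatrix}U_1&U_2\end{bmatrix}\begin{bmatrix}T_{11}&T_{12}\\0&T_{22}\end{bmatrix}\begin{bmatrix}U_1&U_2\end{bmatrix}^*, \] where $U_1\in\mathbf{C}^{n\times r}$, $U_2\in\mathbf{C}^{n\times(n-r)}$, the matrix $[U_1\ U_2]$ is unitary, and $T_{11}$, $T_{22}$ are upper triangular. Put \[ \mathsf{gap}=\min\{\mathsf{sep}_2(T_{11},T_{22}),\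 \mathsf{sep}_{(2,\infty),U_2}(T_{11},U_2T_{22}U_2^*)\}. \] Let $E\in\mathbf{C}^{n\times n}$ be arbitrary, and write $E_{21}=U_2^*EU_1$. If $\|E\|_2\le \mathsf{gap}/10$ and $\|T_{12}\|_2\le\mathsf{gap}/10$, then there is a matrix $\widehat Y\in\mathbf{C}^{(n-r)\times r}$ such that the columns of \[ \widehat U_1=(U_1+U_2\widehat Y)(I+\widehat Y^*\widehat Y)^{-1/2} \] form an orthonormal basis of an invariant subspace of $A+E$, and \[ \min_{Q\in\mathbf{O}^r}\|\widehat U_1Q-U_1\|_{2,\infty}\le 8\|U_1\|_{2,\infty}\left(\frac{\|E\|_2}{\mathsf{sep}_2(T_{11},T_{22})}\right)^2+2\,\frac{\|U_2U_2^*EU_1\|_{2,\infty}}{\mathsf{gap}}+4\,\frac{\|U_2U_2^*EU_2U_2^*\|_{2,\infty}\,\|E_{21}\|_2}{\mathsf{gap}\cdot\mathsf{sep}_2(T_{11},T_{22})}. \] (If $\mathsf{gap}=0$ the hypotheses force $E=0$, and the three terms on the right are then read as $0$.) -/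

import Mathlib

open scoped Matrix

namespace SchurPerturbation

noncomputable section

/-- The spectral norm `‖M‖₂`: the operator norm induced by the Euclidean vector norms. -/
def specNorm {m l : ℕ} (M : Matrix (Fin m) (Fin l) ℂ) : ℝ :=
  ‖(Matrix.toEuclideanLin M).toContinuousLinearMap‖

/-- The two-to-infinity norm `‖M‖_{2,∞}`: the largest Euclidean norm of a row. -/
def twoInfNorm {m l : ℕ} (M : Matrix (Fin m) (Fin l) ℂ) : ℝ :=
  ⨆ i : Fin m, ‖WithLp.toLp 2 (M i)‖

/-- The separation `inf {N (Z B - C Z) : N Z = 1}` of `B` and `C` with respect to a norm `N`. -/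
def sep {m l : ℕ} (N : Matrix (Fin m) (Fin l) ℂ → ℝ)
    (B : Matrix (Fin l) (Fin l) ℂ) (C : Matrix (Fin m) (Fin m) ℂ) : ℝ :=
  sInf {x : ℝ | ∃ Z : Matrix (Fin m) (Fin l) ℂ, N Z = 1 ∧ x = N (Z * B - C * Z)}

/-- The separation of `B` and `C` restricted to those matrices `Z` whose columns lie in the
range of `W`, that is, to the matrices `Z = W X`. -/
def sepOn {n k l : ℕ} (N : Matrix (Fin n) (Fin l) ℂ → ℝ) (W : Matrix (Fin n) (Fin k) ℂ)
    (B : Matrix (Fin l) (Fin l) ℂ) (C : Matrix (Fin n) (Fin n) ℂ) : ℝ :=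
  sInf {x : ℝ | ∃ Z : Matrix (Fin n) (Fin l) ℂ,
    (∃ X : Matrix (Fin k) (Fin l) ℂ, Z = W * X) ∧ N Z = 1 ∧ x = N (Z * B - C * Z)}

/-- `A = [U₁ U₂] [T₁₁ T₁₂; 0 T₂₂] [U₁ U₂]ᴴ` is a Schur form: `[U₁ U₂]` is unitary, and the
diagonal blocks `T₁₁`, `T₂₂` are upper triangular. -/
structure IsSchurForm {n r k : ℕ} (A : Matrix (Fin n) (Fin n) ℂ)
    (U₁ : Matrix (Fin n) (Fin r) ℂ) (U₂ : Matrix (Fin n) (Fin k) ℂ)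
    (T₁₁ : Matrix (Fin r) (Fin r) ℂ) (T₁₂ : Matrix (Fin r) (Fin k) ℂ)
    (T₂₂ : Matrix (Fin k) (Fin k) ℂ) : Prop where
  conjTranspose_mul_self :
    (Matrix.fromCols U₁ U₂)ᴴ * Matrix.fromCols U₁ U₂ = 1
  mul_conjTranspose_self :
    Matrix.fromCols U₁ U₂ * (Matrix.fromCols U₁ U₂)ᴴ = 1
  upper₁ : T₁₁.BlockTriangular id
  upper₂ : T₂₂.BlockTriangular id
  eq : A = Matrix.fromCols U₁ U₂ * Matrix.fromBlocks T₁₁ T₁₂ 0 T₂₂ * (Matrix.fromCols U₁ U₂)ᴴ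

/-- `gap = min {sep₂(T₁₁, T₂₂), sep_{(2,∞),U₂}(T₁₁, U₂ T₂₂ U₂ᴴ)}`. -/
def gap {n r k : ℕ} (U₂ : Matrix (Fin n) (Fin k) ℂ)
    (T₁₁ : Matrix (Fin r) (Fin r) ℂ) (T₂₂ : Matrix (Fin k) (Fin k) ℂ) : ℝ :=
  min (sep specNorm T₁₁ T₂₂) (sepOn twoInfNorm U₂ T₁₁ (U₂ * T₂₂ * U₂ᴴ))

/-- The inverse square root `M^{-1/2}` of a Hermitian positive definite matrix, by functional
calculus. -/
def invSqrt {r : ℕ} (M : Matrix (Fin r) (Fin r) ℂ) : Matrix (Fin r) (Fin r) ℂ :=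
  cfc (fun x : ℝ => x ^ (-(1 / 2) : ℝ)) M

/-- The matrix `(U₁ + U₂ Y) (I + Yᴴ Y)^{-1/2}`. -/
def perturbedBasis {n r k : ℕ} (U₁ : Matrix (Fin n) (Fin r) ℂ) (U₂ : Matrix (Fin n) (Fin k) ℂ)
    (Y : Matrix (Fin k) (Fin r) ℂ) : Matrix (Fin n) (Fin r) ℂ :=
  (U₁ + U₂ * Y) * invSqrt (1 + Yᴴ * Y)

end

end SchurPerturbation

/-!
The column space of `U₁ + U₂ Y` is invariant under `A + E` as soon as `Y` solves the Riccati
equation `Y T₁₁ - T₂₂ Y = E₂₁ + E₂₂ Y - Y E₁₁ - Y (T₁₂ + E₁₂) Y`, where `Eᵢⱼ = Uᵢᴴ E Uⱼ`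
(`IsSchurForm.mul_graph`). If `sep₂ = sep₂(T₁₁, T₂₂)` is positive, the Sylvester operator on the
left is injective, hence invertible, with inverse of norm at most `1 / sep₂`. Banach's fixed
point theorem then yields a solution with `‖Y‖₂ ≤ 2 ‖E₂₁‖₂ / sep₂` (`exists_riccati_solution`).

The same equation multiplied by `U₂` is a Sylvester equation for `U₂ Y`. Since
`‖M K‖_{2,∞} ≤ ‖M‖_{2,∞} ‖K‖₂`, the separation in the two-to-infinity norm bounds
`‖U₂ Y‖_{2,∞}` by the last two terms of the claim (`IsSchurForm.twoInfNorm_mul_le`).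

Finally, with `S = (1 + Yᴴ Y)^{-1/2}`, the choice `Q = 1` gives
`Û₁ - U₁ = U₁ (S - 1) + U₂ Y S`, where `‖S‖₂ ≤ 1` and `‖S - 1‖₂ ≤ ‖Y‖₂² / 2`
because the spectrum of `1 + Yᴴ Y` lies in `[1, 1 + ‖Y‖₂²]`. If the gap vanishes, then `E = 0`
and `Y = 0` works.
-/

namespace SchurPerturbation

open scoped Matrix.Norms.L2Operator

variable {k l m n r : ℕ}

/-! ### The two norms -/

theorem specNorm_eq_norm (M : Matrix (Fin m) (Fin l) ℂ) : specNorm M = ‖M‖ := rfl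

theorem twoInfNorm_eq_pi_norm (M : Matrix (Fin m) (Fin l) ℂ) :
    twoInfNorm M = ‖fun i => (WithLp.toLp 2 (M i) : EuclideanSpace ℂ (Fin l))‖ := by
  apply le_antisymm
  · exact Real.iSup_le (norm_le_pi_norm fun i => (WithLp.toLp 2 (M i) : EuclideanSpace ℂ (Fin l)))
      (norm_nonneg _)
  · refine (pi_norm_le_iff_of_nonneg (Real.iSup_nonneg fun _ => norm_nonneg _)).2 fun i => ?_
    exact le_ciSup (f := fun i => ‖WithLp.toLp 2 (M i)‖) (Set.finite_range _).bddAbove i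

/-- The two-to-infinity norm as a seminorm. -/
noncomputable def twoInfSeminorm (m l : ℕ) : Seminorm ℂ (Matrix (Fin m) (Fin l) ℂ) :=
  Seminorm.of twoInfNorm
    (fun M K => by
      simp only [twoInfNorm_eq_pi_norm]
      exact norm_add_le (fun i => (WithLp.toLp 2 (M i) : EuclideanSpace ℂ (Fin l)))
        (fun i => WithLp.toLp 2 (K i)))
    (fun c M => by
      simp only [twoInfNorm_eq_pi_norm]
      exact norm_smul c (fun i => (WithLp.toLp 2 (M i) : EuclideanSpace ℂ (Fin l))))

theorem twoInfNorm_nonneg (M : Matrix (Fin m) (Fin l) ℂ) : 0 ≤ twoInfNorm M :=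
  apply_nonneg (twoInfSeminorm m l) M

theorem twoInfNorm_zero : twoInfNorm (0 : Matrix (Fin m) (Fin l) ℂ) = 0 :=
  map_zero (twoInfSeminorm m l)

theorem twoInfNorm_add_le (M K : Matrix (Fin m) (Fin l) ℂ) :
    twoInfNorm (M + K) ≤ twoInfNorm M + twoInfNorm K :=
  map_add_le_add (twoInfSeminorm m l) M K

theorem twoInfNorm_sub_le (M K : Matrix (Fin m) (Fin l) ℂ) :
    twoInfNorm (M - K) ≤ twoInfNorm M + twoInfNorm K :=
  map_sub_le_add (twoInfSeminorm m l) M K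

theorem continuous_twoInfNorm :
    Continuous (twoInfNorm : Matrix (Fin m) (Fin l) ℂ → ℝ) := by
  have : (twoInfNorm : Matrix (Fin m) (Fin l) ℂ → ℝ) =
      fun M => ‖fun i => (WithLp.toLp 2 (M i) : EuclideanSpace ℂ (Fin l))‖ :=
    funext twoInfNorm_eq_pi_norm
  rw [this]
  refine continuous_norm.comp (continuous_pi fun i => ?_)
  exact (PiLp.continuous_toLp 2 _).comp (continuous_apply i)

/-- A row of `M K` is the row of `M` times `K`, so only the spectral norm of `K` enters. -/
theorem twoInfNorm_mul_le (M : Matrix (Fin m) (Fin l) ℂ) (K : Matrix (Fin l) (Fin k) ℂ) :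
    twoInfNorm (M * K) ≤ twoInfNorm M * ‖K‖ := by
  have norm_star (p : ℕ) (v : Fin p → ℂ) :
      ‖(WithLp.toLp 2 (star v) : EuclideanSpace ℂ (Fin p))‖ = ‖WithLp.toLp 2 v‖ := by
    simp [EuclideanSpace.norm_eq]
  refine Real.iSup_le (fun i => ?_) (mul_nonneg (twoInfNorm_nonneg M) (norm_nonneg K))
  have hrow : ‖WithLp.toLp 2 (M i)‖ ≤ twoInfNorm M :=
    le_ciSup (f := fun i => ‖WithLp.toLp 2 (M i)‖) (Set.finite_range _).bddAbove i
  have h := Matrix.l2_opNorm_mulVec Kᴴ (WithLp.toLp 2 (star (M i)))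
  rw [Matrix.l2_opNorm_conjTranspose, norm_star] at h
  have hstar : Kᴴ *ᵥ star (M i) = star ((M * K) i) := by
    rw [← Matrix.star_vecMul]; rfl
  have h' : ‖WithLp.toLp 2 ((M * K) i)‖ ≤ ‖K‖ * ‖WithLp.toLp 2 (M i)‖ := by
    rw [← norm_star, ← hstar]; exact h
  calc _ ≤ _ := h'
    _ ≤ ‖K‖ * twoInfNorm M := by gcongr
    _ = _ := mul_comm _ _

/-! ### Separation -/

/-- Both separations are infima of this form. By homogeneity they bound `p (L Z)` from below for
every `Z` in the subspace `S`, not only for normalized ones. -/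
theorem sInf_seminorm_map_mul_le {V : Type*} [AddCommGroup V] [Module ℂ V] (p : Seminorm ℂ V)
    (L : V →ₗ[ℂ] V) (S : Submodule ℂ V) {Z : V} (hZ : Z ∈ S) :
    sInf {x : ℝ | ∃ Z ∈ S, p Z = 1 ∧ x = p (L Z)} * p Z ≤ p (L Z) := by
  rcases (apply_nonneg p Z).eq_or_lt with h | h
  · rw [← h, mul_zero]; exact apply_nonneg p _
  rw [← le_div_iff₀ h]
  refine csInf_le ⟨0, ?_⟩ ⟨((p Z : ℂ)⁻¹) • Z, S.smul_mem _ hZ, ?_, ?_⟩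
  · rintro _ ⟨_, _, _, rfl⟩; exact apply_nonneg p _
  · rw [map_smul_eq_mul, norm_inv, Complex.norm_real, Real.norm_of_nonneg h.le,
      inv_mul_cancel₀ h.ne']
  · rw [map_smul, map_smul_eq_mul, norm_inv, Complex.norm_real, Real.norm_of_nonneg h.le,
      div_eq_inv_mul]

/-- The Sylvester operator `Z ↦ Z B - C Z`. -/
def sylvester (B : Matrix (Fin l) (Fin l) ℂ) (C : Matrix (Fin m) (Fin m) ℂ) :
    Matrix (Fin m) (Fin l) ℂ →ₗ[ℂ] Matrix (Fin m) (Fin l) ℂ where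
  toFun Z := Z * B - C * Z
  map_add' Z W := by rw [Matrix.add_mul, Matrix.mul_add]; abel
  map_smul' c Z := by simp [smul_sub]

theorem sep_specNorm_mul_le (B : Matrix (Fin l) (Fin l) ℂ) (C : Matrix (Fin m) (Fin m) ℂ)
    (Z : Matrix (Fin m) (Fin l) ℂ) : sep specNorm B C * ‖Z‖ ≤ ‖Z * B - C * Z‖ := by
  have h := sInf_seminorm_map_mul_le (normSeminorm ℂ (Matrix (Fin m) (Fin l) ℂ)) (sylvester B C) ⊤
    (Submodule.mem_top (x := Z))
  simp only [Submodule.mem_top, true_and] at h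
  exact h

theorem sepOn_twoInfNorm_mul_le (W : Matrix (Fin n) (Fin k) ℂ) (B : Matrix (Fin l) (Fin l) ℂ)
    (C : Matrix (Fin n) (Fin n) ℂ) (X : Matrix (Fin k) (Fin l) ℂ) :
    sepOn twoInfNorm W B C * twoInfNorm (W * X) ≤ twoInfNorm (W * X * B - C * (W * X)) := by
  have h := sInf_seminorm_map_mul_le (twoInfSeminorm n l) (sylvester B C)
    (LinearMap.range (mulLeftLinearMap (Fin l) ℂ W)) (Z := W * X) ⟨X, rfl⟩
  simp only [LinearMap.mem_range, mulLeftLinearMap_apply,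
    eq_comm (b := (_ : Matrix _ _ ℂ))] at h
  exact h

theorem gap_nonneg (U₂ : Matrix (Fin n) (Fin k) ℂ) (T₁₁ : Matrix (Fin r) (Fin r) ℂ)
    (T₂₂ : Matrix (Fin k) (Fin k) ℂ) : 0 ≤ gap U₂ T₁₁ T₂₂ := by
  refine le_min (Real.sInf_nonneg ?_) (Real.sInf_nonneg ?_)
  · rintro _ ⟨_, _, rfl⟩; exact norm_nonneg _
  · rintro _ ⟨_, _, _, rfl⟩; exact twoInfNorm_nonneg _

/-! ### The Riccati equation -/

/-- The Riccati equation that characterizes invariant graph subspaces has a small solution: its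
linear part has an inverse of norm at most `1 / s`, and that inverse applied to the right-hand side
is a contraction by `1 / 2` of the ball of radius `2 ‖G‖ / s` into itself. -/
theorem exists_riccati_solution (B H : Matrix (Fin r) (Fin r) ℂ) (C F : Matrix (Fin k) (Fin k) ℂ)
    (G : Matrix (Fin k) (Fin r) ℂ) (K : Matrix (Fin r) (Fin k) ℂ) {s : ℝ} (hs : 0 < s)
    (hsep : ∀ Z : Matrix (Fin k) (Fin r) ℂ, s * ‖Z‖ ≤ ‖Z * B - C * Z‖)
    (hG : ‖G‖ ≤ s / 10) (hF : ‖F‖ ≤ s / 10) (hH : ‖H‖ ≤ s / 10) (hK : ‖K‖ ≤ s / 5) :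
    ∃ Y : Matrix (Fin k) (Fin r) ℂ, ‖Y‖ ≤ 2 * ‖G‖ / s ∧
      Y * B - C * Y = G + F * Y - Y * H - Y * K * Y := by
  have hinj : Function.Injective (sylvester B C) := by
    refine (injective_iff_map_eq_zero _).2 fun Z hZ => ?_
    have h := hsep Z
    rw [show Z * B - C * Z = 0 from hZ, norm_zero] at h
    exact norm_le_zero_iff.1 (nonpos_of_mul_nonpos_right h hs)
  let L := LinearEquiv.ofInjectiveEndo (sylvester B C) hinj
  have hL (Z : Matrix (Fin k) (Fin r) ℂ) : L Z = Z * B - C * Z := rfl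
  have hLsymm (W : Matrix (Fin k) (Fin r) ℂ) : ‖L.symm W‖ ≤ ‖W‖ / s := by
    rw [le_div_iff₀' hs]
    have h := hsep (L.symm W)
    rwa [← hL, L.apply_symm_apply] at h
  let R : Matrix (Fin k) (Fin r) ℂ → Matrix (Fin k) (Fin r) ℂ :=
    fun Y => G + F * Y - Y * H - Y * K * Y
  set ρ := 2 * ‖G‖ / s with hρ
  have hρ0 : 0 ≤ ρ := by positivity
  have hρ5 : ρ ≤ 1 / 5 := by
    rw [hρ, div_le_iff₀ hs]; linarith
  have hR {Y Z : Matrix (Fin k) (Fin r) ℂ} (hY : ‖Y‖ ≤ ρ) (hZ : ‖Z‖ ≤ ρ) :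
      ‖R Y - R Z‖ ≤ s / 2 * ‖Y - Z‖ := by
    have hsplit : R Y - R Z =
        F * (Y - Z) - (Y - Z) * H - ((Y - Z) * (K * Y) + Z * K * (Y - Z)) := by
      simp only [R, Matrix.mul_sub, Matrix.sub_mul, Matrix.mul_assoc]; abel
    have h1 : ‖F * (Y - Z)‖ ≤ s / 10 * ‖Y - Z‖ := by
      grw [Matrix.l2_opNorm_mul, hF]
    have h2 : ‖(Y - Z) * H‖ ≤ ‖Y - Z‖ * (s / 10) := by
      grw [Matrix.l2_opNorm_mul, hH]
    have h3 : ‖(Y - Z) * (K * Y)‖ ≤ ‖Y - Z‖ * (s / 5 * (1 / 5)) := by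
      grw [Matrix.l2_opNorm_mul, Matrix.l2_opNorm_mul, hK, hY, hρ5]
    have h4 : ‖Z * K * (Y - Z)‖ ≤ 1 / 5 * (s / 5) * ‖Y - Z‖ := by
      grw [Matrix.l2_opNorm_mul, Matrix.l2_opNorm_mul, hK, hZ, hρ5]
    rw [hsplit]
    grw [norm_sub_le, norm_sub_le, norm_add_le, h1, h2, h3, h4]
    nlinarith [mul_nonneg hs.le (norm_nonneg (Y - Z))]
  have hmaps : Set.MapsTo (fun Y => L.symm (R Y)) (Metric.closedBall 0 ρ)
      (Metric.closedBall 0 ρ) := by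
    intro Y hY
    rw [mem_closedBall_zero_iff] at hY ⊢
    grw [hLsymm, div_le_iff₀ hs]
    have h := hR hY (norm_zero.trans_le hρ0)
    have hR0 : R 0 = G := by simp [R]
    rw [hR0, sub_zero] at h
    calc ‖R Y‖ ≤ ‖R Y - G‖ + ‖G‖ := norm_le_norm_sub_add _ _
      _ ≤ s / 2 * ρ + ‖G‖ := by grw [h, hY]
      _ = ρ * s := by rw [hρ]; field_simp; ring
  have hlip : LipschitzOnWith (1 / 2) (fun Y => L.symm (R Y)) (Metric.closedBall 0 ρ) := by
    refine LipschitzOnWith.of_dist_le_mul fun Y hY Z hZ => ?_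
    rw [mem_closedBall_zero_iff] at hY hZ
    rw [dist_eq_norm, dist_eq_norm, ← map_sub]
    grw [hLsymm, hR hY hZ]
    apply le_of_eq
    push_cast
    field_simp
  obtain ⟨Y, hY, hfix, -⟩ := ContractingWith.exists_fixedPoint'
    (Metric.isClosed_closedBall.isComplete) hmaps
    (K := 1 / 2) ⟨by rw [← NNReal.coe_lt_coe]; norm_num, hlip.mapsToRestrict hmaps⟩
    (Metric.mem_closedBall_self hρ0) (edist_ne_top _ _)
  refine ⟨Y, mem_closedBall_zero_iff.1 hY, ?_⟩
  rw [← hL]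
  have h := congrArg L hfix.eq
  simpa [R] using h.symm

/-! ### The inverse square root of `1 + Yᴴ Y` -/

open scoped ComplexOrder in
theorem mem_spectrum_one_add_gram (Y : Matrix (Fin k) (Fin r) ℂ) {x : ℝ}
    (hx : x ∈ spectrum ℝ (1 + Yᴴ * Y)) : 1 ≤ x ∧ x ≤ 1 + ‖Y‖ ^ 2 := by
  have hx' : x - 1 ∈ spectrum ℝ (Yᴴ * Y) := by
    rw [← spectrum.add_mem_add_iff (s := 1)]
    simpa [add_comm] using hx
  constructor
  · have h := (Matrix.posSemidef_iff_isHermitian_and_spectrum_nonneg.1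
      (Matrix.posSemidef_conjTranspose_mul_self Y)).2 
    have h0 : (0 : ℂ) ≤ ((x - 1 : ℝ) : ℂ) := h hx'
    exact sub_nonneg.1 (Complex.zero_le_real.1 h0)
  · have : Nontrivial (Matrix (Fin r) (Fin r) ℂ) := by
      by_contra h
      rw [not_nontrivial_iff_subsingleton] at h
      simp [spectrum.of_subsingleton] at hx
    have h := spectrum.norm_le_norm_of_mem hx'
    rw [Matrix.l2_opNorm_conjTranspose_mul_self] at h
    linarith [le_abs_self (x - 1), Real.norm_eq_abs (x - 1)]

theorem continuousOn_rpow_spectrum_one_add_gram (Y : Matrix (Fin k) (Fin r) ℂ) :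
    ContinuousOn (fun x : ℝ => x ^ (-(1 / 2) : ℝ)) (spectrum ℝ (1 + Yᴴ * Y)) :=
  fun x hx => (Real.continuousAt_rpow_const x _
    (Or.inl (by linarith [(mem_spectrum_one_add_gram Y hx).1]))).continuousWithinAt

theorem isSelfAdjoint_one_add_gram (Y : Matrix (Fin k) (Fin r) ℂ) :
    IsSelfAdjoint (1 + Yᴴ * Y) :=
  (IsSelfAdjoint.one _).add (Matrix.isHermitian_conjTranspose_mul_self Y)

theorem invSqrt_conjTranspose (M : Matrix (Fin r) (Fin r) ℂ) : (invSqrt M)ᴴ = invSqrt M :=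
  IsSelfAdjoint.star_eq (cfc_predicate (p := IsSelfAdjoint) _ M)

/-- `M^{-1/2} M M^{-1/2} = 1` for `M = 1 + Yᴴ Y`, bracketed so that `M M^{-1/2}` appears as the
inverse of `M^{-1/2}`. -/
theorem invSqrt_mul_mul_invSqrt (Y : Matrix (Fin k) (Fin r) ℂ) :
    invSqrt (1 + Yᴴ * Y) * ((1 + Yᴴ * Y) * invSqrt (1 + Yᴴ * Y)) = 1 := by
  have hsa := isSelfAdjoint_one_add_gram Y
  have hcont := continuousOn_rpow_spectrum_one_add_gram Y
  have h : (1 + Yᴴ * Y) * invSqrt (1 + Yᴴ * Y) =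
      cfc (fun x : ℝ => x * x ^ (-(1 / 2) : ℝ)) (1 + Yᴴ * Y) := by
    rw [cfc_mul _ _ _ (continuousOn_id' _) hcont, cfc_id' ℝ _ hsa]; rfl
  rw [h, invSqrt]
  refine (cfc_mul _ _ _ hcont ((continuousOn_id' _).mul hcont)).symm.trans ?_
  refine Eq.trans ?_ (cfc_one ℝ (1 + Yᴴ * Y) hsa)
  refine cfc_congr fun x hx => ?_
  have hx0 : 0 < x := by linarith [(mem_spectrum_one_add_gram Y hx).1]
  have h2 : x ^ (-(1 / 2) : ℝ) * x ^ (-(1 / 2) : ℝ) = x⁻¹ := by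
    rw [← Real.rpow_add hx0, ← Real.rpow_neg_one]; norm_num
  simp only [Pi.one_apply, Pi.mul_apply]
  rw [mul_left_comm, h2, mul_inv_cancel₀ hx0.ne']

theorem norm_invSqrt_le_one (Y : Matrix (Fin k) (Fin r) ℂ) : ‖invSqrt (1 + Yᴴ * Y)‖ ≤ 1 := by
  refine norm_cfc_le zero_le_one fun x hx => ?_
  have hx1 := (mem_spectrum_one_add_gram Y hx).1
  rw [Real.norm_of_nonneg (by positivity)]
  exact Real.rpow_le_one_of_one_le_of_nonpos hx1 (by norm_num)

theorem norm_invSqrt_sub_one_le (Y : Matrix (Fin k) (Fin r) ℂ) :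
    ‖invSqrt (1 + Yᴴ * Y) - 1‖ ≤ ‖Y‖ ^ 2 / 2 := by
  have hsa := isSelfAdjoint_one_add_gram Y
  have hcont := continuousOn_rpow_spectrum_one_add_gram Y
  have h : invSqrt (1 + Yᴴ * Y) - 1 =
      cfc (fun x : ℝ => x ^ (-(1 / 2) : ℝ) - 1) (1 + Yᴴ * Y) := by
    rw [cfc_sub _ _ _ hcont continuousOn_const, cfc_const_one ℝ _ hsa]; rfl
  rw [h]
  refine norm_cfc_le (by positivity) fun x hx => ?_
  obtain ⟨hx1, hx2⟩ := mem_spectrum_one_add_gram Y hx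
  have hle : x ^ (-(1 / 2) : ℝ) ≤ 1 := Real.rpow_le_one_of_one_le_of_nonpos hx1 (by norm_num)
  have hx0 : 0 < x := by linarith
  have hy0 : 0 < x ^ (-(1 / 2) : ℝ) := Real.rpow_pos_of_pos hx0 _
  have hsq : x ^ (-(1 / 2) : ℝ) * x ^ (-(1 / 2) : ℝ) * x = 1 := by
    rw [← Real.rpow_add hx0, ← Real.rpow_add_one hx0.ne']; norm_num
  set y := x ^ (-(1 / 2) : ℝ)
  rw [Real.norm_eq_abs, abs_of_nonpos (by linarith)]
  -- The inequality `1 - y ≤ (x - 1) / 2` for `x = y⁻²`, `0 < y ≤ 1`.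
  have hxy : (x + 1) * y ≥ 2 := by
    nlinarith [sq_nonneg (y - 1)]
  nlinarith

/-! ### The minimum over the orthogonal group -/

/-- The minimum over `Q` is attained because the real orthogonal group is compact. -/
theorem exists_isLeast_twoInfNorm_orthogonal (P U : Matrix (Fin n) (Fin r) ℂ) :
    ∃ δ : ℝ, IsLeast {x : ℝ | ∃ Q ∈ Matrix.orthogonalGroup (Fin r) ℝ,
      x = twoInfNorm (P * Q.map Complex.ofReal - U)} δ := by
  have hcompact :
      IsCompact (Matrix.orthogonalGroup (Fin r) ℝ : Set (Matrix (Fin r) (Fin r) ℝ)) := by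
    have hbox : IsCompact {Q : Matrix (Fin r) (Fin r) ℝ |
        ∀ i, Q i ∈ {v : Fin r → ℝ | ∀ j, v j ∈ Metric.closedBall (0 : ℝ) 1}} :=
      isCompact_pi_infinite fun _ => isCompact_pi_infinite fun _ => isCompact_closedBall 0 1
    refine hbox.of_isClosed_subset (isClosed_unitary) fun Q hQ i j => ?_
    simpa using entry_norm_bound_of_unitary hQ i j
  have hcont : Continuous fun Q : Matrix (Fin r) (Fin r) ℝ =>
      twoInfNorm (P * Q.map Complex.ofReal - U) := by
    refine continuous_twoInfNorm.comp ?_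
    exact (continuous_const.matrix_mul
      (continuous_id.matrix_map Complex.continuous_ofReal)).sub continuous_const
  obtain ⟨Q, hQ, hmin⟩ := hcompact.exists_isMinOn ⟨1, one_mem _⟩ hcont.continuousOn
  refine ⟨_, ⟨Q, hQ, rfl⟩, ?_⟩
  rintro _ ⟨Q', hQ', rfl⟩
  exact hmin hQ'

/-! ### Invariant graph subspaces of a perturbed Schur form -/

theorem norm_le_one_of_conjTranspose_mul_self {U : Matrix (Fin n) (Fin k) ℂ} (hU : Uᴴ * U = 1) :
    ‖U‖ ≤ 1 := by
  have h := Matrix.l2_opNorm_conjTranspose_mul_self U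
  have h1 : ‖(1 : Matrix (Fin k) (Fin k) ℂ)‖ ≤ 1 := by
    rw [← Matrix.diagonal_one, Matrix.l2_opNorm_diagonal]
    exact (pi_norm_le_iff_of_nonneg zero_le_one).2 fun i => by simp
  rw [hU] at h
  nlinarith [norm_nonneg U]

theorem norm_compression_le {U : Matrix (Fin n) (Fin k) ℂ} {W : Matrix (Fin n) (Fin l) ℂ}
    (hU : Uᴴ * U = 1) (hW : Wᴴ * W = 1) (E : Matrix (Fin n) (Fin n) ℂ) :
    ‖Uᴴ * E * W‖ ≤ ‖E‖ := by
  grw [Matrix.l2_opNorm_mul, Matrix.l2_opNorm_mul, Matrix.l2_opNorm_conjTranspose,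
    norm_le_one_of_conjTranspose_mul_self hU, norm_le_one_of_conjTranspose_mul_self hW]
  simp

section SchurForm

variable {A : Matrix (Fin n) (Fin n) ℂ} {U₁ : Matrix (Fin n) (Fin r) ℂ}
  {U₂ : Matrix (Fin n) (Fin k) ℂ} {T₁₁ : Matrix (Fin r) (Fin r) ℂ}
  {T₁₂ : Matrix (Fin r) (Fin k) ℂ} {T₂₂ : Matrix (Fin k) (Fin k) ℂ}

theorem IsSchurForm.orthonormal_blocks (hA : IsSchurForm A U₁ U₂ T₁₁ T₁₂ T₂₂) :
    U₁ᴴ * U₁ = 1 ∧ U₁ᴴ * U₂ = 0 ∧ U₂ᴴ * U₁ = 0 ∧ U₂ᴴ * U₂ = 1 := by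
  have h := hA.conjTranspose_mul_self
  rw [Matrix.conjTranspose_fromCols_eq_fromRows_conjTranspose, Matrix.fromRows_mul_fromCols,
    ← Matrix.fromBlocks_one, Matrix.fromBlocks_inj] at h
  exact h

theorem IsSchurForm.resolution_of_one (hA : IsSchurForm A U₁ U₂ T₁₁ T₁₂ T₂₂) :
    U₁ * U₁ᴴ + U₂ * U₂ᴴ = 1 := by
  have h := hA.mul_conjTranspose_self
  rwa [Matrix.conjTranspose_fromCols_eq_fromRows_conjTranspose, Matrix.fromCols_mul_fromRows] at h

theorem IsSchurForm.mul_basis (hA : IsSchurForm A U₁ U₂ T₁₁ T₁₂ T₂₂) :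
    A * U₁ = U₁ * T₁₁ ∧ A * U₂ = U₁ * T₁₂ + U₂ * T₂₂ := by
  have h : A * Matrix.fromCols U₁ U₂ =
      Matrix.fromCols U₁ U₂ * Matrix.fromBlocks T₁₁ T₁₂ 0 T₂₂ := by
    rw [hA.eq, Matrix.mul_assoc, hA.conjTranspose_mul_self, Matrix.mul_one]
  rw [Matrix.mul_fromCols, Matrix.fromCols_mul_fromBlocks] at h
  simpa using Matrix.fromCols_inj h

/-- A solution of the Riccati equation gives an invariant graph subspace. -/
theorem IsSchurForm.mul_graph (hA : IsSchurForm A U₁ U₂ T₁₁ T₁₂ T₂₂)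
    (E : Matrix (Fin n) (Fin n) ℂ) {Y : Matrix (Fin k) (Fin r) ℂ}
    (hY : Y * T₁₁ - T₂₂ * Y = U₂ᴴ * E * U₁ + U₂ᴴ * E * U₂ * Y - Y * (U₁ᴴ * E * U₁)
      - Y * (T₁₂ + U₁ᴴ * E * U₂) * Y) :
    (A + E) * (U₁ + U₂ * Y) =
      (U₁ + U₂ * Y) * (T₁₁ + U₁ᴴ * E * U₁ + (T₁₂ + U₁ᴴ * E * U₂) * Y) := by
  obtain ⟨h1, h2⟩ := hA.mul_basis
  have hE (W : Matrix (Fin n) (Fin r) ℂ) :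
      E * W = U₁ * (U₁ᴴ * E * W) + U₂ * (U₂ᴴ * E * W) := by
    calc E * W = (U₁ * U₁ᴴ + U₂ * U₂ᴴ) * (E * W) := by rw [hA.resolution_of_one, Matrix.one_mul]
      _ = _ := by simp only [Matrix.add_mul, Matrix.mul_assoc]
  have hYT : Y * T₁₁ = T₂₂ * Y + (U₂ᴴ * E * U₁ + U₂ᴴ * E * U₂ * Y - Y * (U₁ᴴ * E * U₁)
      - Y * (T₁₂ + U₁ᴴ * E * U₂) * Y) := by rw [← hY]; abel
  have hR : (U₁ + U₂ * Y) * (T₁₁ + U₁ᴴ * E * U₁ + (T₁₂ + U₁ᴴ * E * U₂) * Y) =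
      U₁ * (T₁₁ + U₁ᴴ * E * U₁ + (T₁₂ + U₁ᴴ * E * U₂) * Y) +
      U₂ * (Y * T₁₁ + Y * (U₁ᴴ * E * U₁) + Y * (T₁₂ + U₁ᴴ * E * U₂) * Y) := by
    simp only [Matrix.add_mul, Matrix.mul_add, Matrix.mul_assoc]
    abel
  have hAY : A * (U₁ + U₂ * Y) = U₁ * T₁₁ + (U₁ * T₁₂ + U₂ * T₂₂) * Y := by
    rw [Matrix.mul_add, ← Matrix.mul_assoc, h1, h2]
  rw [hR, hYT, Matrix.add_mul, hAY, hE]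
  simp only [Matrix.add_mul, Matrix.mul_add, Matrix.mul_sub, Matrix.mul_assoc]
  abel

theorem perturbedBasis_conjTranspose_mul_self (hA : IsSchurForm A U₁ U₂ T₁₁ T₁₂ T₂₂)
    (Y : Matrix (Fin k) (Fin r) ℂ) :
    (perturbedBasis U₁ U₂ Y)ᴴ * perturbedBasis U₁ U₂ Y = 1 := by
  obtain ⟨h11, h12, h21, h22⟩ := hA.orthonormal_blocks
  have hgram : (U₁ + U₂ * Y)ᴴ * (U₁ + U₂ * Y) = 1 + Yᴴ * Y := by
    calc (U₁ + U₂ * Y)ᴴ * (U₁ + U₂ * Y)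
        = U₁ᴴ * U₁ + U₁ᴴ * U₂ * Y + Yᴴ * (U₂ᴴ * U₁) + Yᴴ * (U₂ᴴ * U₂) * Y := by
          simp only [Matrix.conjTranspose_add, Matrix.conjTranspose_mul, Matrix.add_mul,
            Matrix.mul_add, Matrix.mul_assoc]
          abel
      _ = _ := by simp [h11, h12, h21, h22]
  rw [perturbedBasis, Matrix.conjTranspose_mul, invSqrt_conjTranspose, Matrix.mul_assoc,
    ← Matrix.mul_assoc _ _ (invSqrt _), hgram, invSqrt_mul_mul_invSqrt]

theorem range_perturbedBasis_mem_invtSubmodule {M : Matrix (Fin n) (Fin n) ℂ}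
    {Y : Matrix (Fin k) (Fin r) ℂ} {K : Matrix (Fin r) (Fin r) ℂ}
    (hM : M * (U₁ + U₂ * Y) = (U₁ + U₂ * Y) * K) :
    LinearMap.range (Matrix.mulVecLin (perturbedBasis U₁ U₂ Y)) ∈
      Module.End.invtSubmodule (Matrix.mulVecLin M) := by
  have h : M * perturbedBasis U₁ U₂ Y = perturbedBasis U₁ U₂ Y *
      ((1 + Yᴴ * Y) * invSqrt (1 + Yᴴ * Y) * K * invSqrt (1 + Yᴴ * Y)) := by
    have h1 : (U₁ + U₂ * Y) * invSqrt (1 + Yᴴ * Y) * ((1 + Yᴴ * Y) * invSqrt (1 + Yᴴ * Y)) =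
        U₁ + U₂ * Y := by
      rw [Matrix.mul_assoc, invSqrt_mul_mul_invSqrt, Matrix.mul_one]
    rw [perturbedBasis, Matrix.mul_assoc _ K, ← Matrix.mul_assoc _ _ (K * _), h1,
      ← Matrix.mul_assoc, hM, Matrix.mul_assoc]
  rw [Module.End.mem_invtSubmodule]
  rintro _ ⟨v, rfl⟩
  refine ⟨((1 + Yᴴ * Y) * invSqrt (1 + Yᴴ * Y) * K * invSqrt (1 + Yᴴ * Y)) *ᵥ v, ?_⟩
  simp only [Matrix.mulVecLin_apply, Matrix.mulVec_mulVec, h]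

theorem twoInfNorm_perturbedBasis_sub_le (U₁ : Matrix (Fin n) (Fin r) ℂ)
    (U₂ : Matrix (Fin n) (Fin k) ℂ) (Y : Matrix (Fin k) (Fin r) ℂ) :
    twoInfNorm (perturbedBasis U₁ U₂ Y - U₁) ≤
      twoInfNorm U₁ * (‖Y‖ ^ 2 / 2) + twoInfNorm (U₂ * Y) := by
  have h : perturbedBasis U₁ U₂ Y - U₁ =
      U₁ * (invSqrt (1 + Yᴴ * Y) - 1) + U₂ * Y * invSqrt (1 + Yᴴ * Y) := by
    rw [perturbedBasis, Matrix.add_mul, Matrix.mul_sub, Matrix.mul_one]; abel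
  have h1 := twoInfNorm_nonneg U₁
  have h2 := twoInfNorm_nonneg (U₂ * Y)
  rw [h]
  grw [twoInfNorm_add_le, twoInfNorm_mul_le, twoInfNorm_mul_le, norm_invSqrt_sub_one_le,
    norm_invSqrt_le_one, mul_one]

/-- Multiplying the Riccati equation by `U₂` puts `U₂ Y` in the range of `U₂`, where the
two-to-infinity separation applies; the terms that contain `U₂ Y` on the right are absorbed on
the left. -/
theorem IsSchurForm.twoInfNorm_mul_le (hA : IsSchurForm A U₁ U₂ T₁₁ T₁₂ T₂₂)
    (E : Matrix (Fin n) (Fin n) ℂ) {Y : Matrix (Fin k) (Fin r) ℂ} {g ρ : ℝ} (hg : 0 < g)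
    (hsep : g ≤ sepOn twoInfNorm U₂ T₁₁ (U₂ * T₂₂ * U₂ᴴ))
    (hE : ‖E‖ ≤ g / 10) (hT : ‖T₁₂‖ ≤ g / 10) (hρ : ‖Y‖ ≤ ρ) (hρ5 : ρ ≤ 1 / 5)
    (hY : Y * T₁₁ - T₂₂ * Y = U₂ᴴ * E * U₁ + U₂ᴴ * E * U₂ * Y - Y * (U₁ᴴ * E * U₁)
      - Y * (T₁₂ + U₁ᴴ * E * U₂) * Y) :
    twoInfNorm (U₂ * Y) ≤ 2 * (twoInfNorm (U₂ * U₂ᴴ * E * U₁) / g) +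
      2 * (twoInfNorm (U₂ * U₂ᴴ * E * U₂ * U₂ᴴ) * ρ / g) := by
  obtain ⟨h11, h12, h21, h22⟩ := hA.orthonormal_blocks
  have hcancel : U₂ᴴ * (U₂ * Y) = Y := by rw [← Matrix.mul_assoc, h22, Matrix.one_mul]
  have hsyl : U₂ * Y * T₁₁ - U₂ * T₂₂ * U₂ᴴ * (U₂ * Y) =
      U₂ * U₂ᴴ * E * U₁ + U₂ * U₂ᴴ * E * U₂ * U₂ᴴ * U₂ * Y - U₂ * Y * (U₁ᴴ * E * U₁)
        - U₂ * Y * ((T₁₂ + U₁ᴴ * E * U₂) * Y) := by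
    have h := congrArg (U₂ * ·) hY
    simp only [Matrix.mul_sub, Matrix.mul_add, Matrix.add_mul, Matrix.mul_assoc, hcancel] at h ⊢
    exact h
  have hK : ‖T₁₂ + U₁ᴴ * E * U₂‖ ≤ g / 5 := by
    grw [norm_add_le, norm_compression_le h11 h22, hE, hT]
    linarith
  have hN := twoInfNorm_nonneg (U₂ * Y)
  have hb := twoInfNorm_nonneg (U₂ * U₂ᴴ * E * U₂ * U₂ᴴ)
  have ha := twoInfNorm_nonneg (U₂ * U₂ᴴ * E * U₁)
  have t2 : twoInfNorm (U₂ * U₂ᴴ * E * U₂ * U₂ᴴ * U₂ * Y) ≤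
      twoInfNorm (U₂ * U₂ᴴ * E * U₂ * U₂ᴴ) * ρ := by
    have hU : ‖U₂ * Y‖ ≤ ρ := by
      grw [Matrix.l2_opNorm_mul, norm_le_one_of_conjTranspose_mul_self h22, one_mul, hρ]
    rw [Matrix.mul_assoc _ U₂ Y]
    grw [SchurPerturbation.twoInfNorm_mul_le, hU]
  have t3 : twoInfNorm (U₂ * Y * (U₁ᴴ * E * U₁)) ≤ twoInfNorm (U₂ * Y) * (g / 10) := by
    grw [SchurPerturbation.twoInfNorm_mul_le, norm_compression_le h11 h11, hE]
  have t4 : twoInfNorm (U₂ * Y * ((T₁₂ + U₁ᴴ * E * U₂) * Y)) ≤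
      twoInfNorm (U₂ * Y) * (g / 5 * (1 / 5)) := by
    grw [SchurPerturbation.twoInfNorm_mul_le, Matrix.l2_opNorm_mul, hK, hρ, hρ5]
  have hmain := sepOn_twoInfNorm_mul_le U₂ T₁₁ (U₂ * T₂₂ * U₂ᴴ) Y
  rw [hsyl] at hmain
  grw [← hsep, twoInfNorm_sub_le, twoInfNorm_sub_le, twoInfNorm_add_le, t2, t3, t4] at hmain
  have hρ0 : 0 ≤ ρ := (norm_nonneg Y).trans hρ
  have hbρ := mul_nonneg hb hρ0
  rw [← mul_div_assoc, ← mul_div_assoc, ← add_div, le_div_iff₀ hg]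
  nlinarith [mul_nonneg hN hg.le]

end SchurForm

end SchurPerturbation

open scoped Matrix.Norms.L2Operator in
theorem theorem4p1 (n r : ℕ) (hr : 0 < r) (hrn : r < n)
    (A E : Matrix (Fin n) (Fin n) ℂ)
    (U₁ : Matrix (Fin n) (Fin r) ℂ) (U₂ : Matrix (Fin n) (Fin (n - r)) ℂ)
    (T₁₁ : Matrix (Fin r) (Fin r) ℂ) (T₁₂ : Matrix (Fin r) (Fin (n - r)) ℂ)
    (T₂₂ : Matrix (Fin (n - r)) (Fin (n - r)) ℂ)
    (hA : SchurPerturbation.IsSchurForm A U₁ U₂ T₁₁ T₁₂ T₂₂)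
    (hE : SchurPerturbation.specNorm E ≤ SchurPerturbation.gap U₂ T₁₁ T₂₂ / 10)
    (hT : SchurPerturbation.specNorm T₁₂ ≤ SchurPerturbation.gap U₂ T₁₁ T₂₂ / 10) :
    ∃ Y : Matrix (Fin (n - r)) (Fin r) ℂ,
      (SchurPerturbation.perturbedBasis U₁ U₂ Y)ᴴ * SchurPerturbation.perturbedBasis U₁ U₂ Y = 1 ∧
      LinearMap.range (Matrix.mulVecLin (SchurPerturbation.perturbedBasis U₁ U₂ Y)) ∈
        Module.End.invtSubmodule (Matrix.mulVecLin (A + E)) ∧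
      ∃ δ : ℝ,
        IsLeast {x : ℝ | ∃ Q ∈ Matrix.orthogonalGroup (Fin r) ℝ,
          x = SchurPerturbation.twoInfNorm
            (SchurPerturbation.perturbedBasis U₁ U₂ Y * Q.map Complex.ofReal - U₁)} δ ∧
        δ ≤ 8 * SchurPerturbation.twoInfNorm U₁ *
              (SchurPerturbation.specNorm E /
                SchurPerturbation.sep SchurPerturbation.specNorm T₁₁ T₂₂) ^ 2
            + 2 * (SchurPerturbation.twoInfNorm (U₂ * U₂ᴴ * E * U₁) /
                SchurPerturbation.gap U₂ T₁₁ T₂₂)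
            + 4 * (SchurPerturbation.twoInfNorm (U₂ * U₂ᴴ * E * U₂ * U₂ᴴ) *
                SchurPerturbation.specNorm (U₂ᴴ * E * U₁) /
                (SchurPerturbation.gap U₂ T₁₁ T₂₂ *
                  SchurPerturbation.sep SchurPerturbation.specNorm T₁₁ T₂₂)) := by
  have hortho := SchurPerturbation.perturbedBasis_conjTranspose_mul_self hA
  set g := SchurPerturbation.gap U₂ T₁₁ T₂₂ with hgdef
  set s := SchurPerturbation.sep SchurPerturbation.specNorm T₁₁ T₂₂ with hsdef
  have hg0 : 0 ≤ g := SchurPerturbation.gap_nonneg U₂ T₁₁ T₂₂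
  have hgs : g ≤ s := min_le_left _ _
  have hN1 := SchurPerturbation.twoInfNorm_nonneg U₁
  -- The choice `Q = 1` reduces the bound on the minimum to one on `Û₁ - U₁`.
  have hmin (Y : Matrix (Fin (n - r)) (Fin r) ℂ) {β : ℝ}
      (hβ : SchurPerturbation.twoInfNorm (SchurPerturbation.perturbedBasis U₁ U₂ Y - U₁) ≤ β) :
      ∃ δ : ℝ, IsLeast {x : ℝ | ∃ Q ∈ Matrix.orthogonalGroup (Fin r) ℝ,
        x = SchurPerturbation.twoInfNorm
          (SchurPerturbation.perturbedBasis U₁ U₂ Y * Q.map Complex.ofReal - U₁)} δ ∧ δ ≤ β := by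
    obtain ⟨δ, hδ⟩ := SchurPerturbation.exists_isLeast_twoInfNorm_orthogonal
      (SchurPerturbation.perturbedBasis U₁ U₂ Y) U₁
    refine ⟨δ, hδ, (hδ.2 ⟨1, one_mem _, rfl⟩).trans ?_⟩
    rwa [Matrix.map_one _ Complex.ofReal_zero Complex.ofReal_one, Matrix.mul_one]
  have ha := SchurPerturbation.twoInfNorm_nonneg (U₂ * U₂ᴴ * E * U₁)
  have hb := SchurPerturbation.twoInfNorm_nonneg (U₂ * U₂ᴴ * E * U₂ * U₂ᴴ)
  rw [SchurPerturbation.specNorm_eq_norm] at hE hT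
  simp only [SchurPerturbation.specNorm_eq_norm]
  rcases hg0.eq_or_lt with hg | hg
  · -- A vanishing gap forces `E = 0`, and `Y = 0` gives the unperturbed subspace.
    have hE0 : E = 0 := norm_le_zero_iff.1 (by rwa [← hg, zero_div] at hE)
    refine ⟨0, hortho 0,
      SchurPerturbation.range_perturbedBasis_mem_invtSubmodule (hA.mul_graph E ?_), hmin 0 ?_⟩
    · simp [hE0]
    · refine (SchurPerturbation.twoInfNorm_perturbedBasis_sub_le U₁ U₂ 0).trans ?_
      rw [Matrix.mul_zero, SchurPerturbation.twoInfNorm_zero, norm_zero]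
      have : 0 ≤ s := hg0.trans hgs
      simp only [ne_eq, OfNat.ofNat_ne_zero, not_false_eq_true, zero_pow, zero_div, mul_zero,
        add_zero]
      positivity
  · have hs : 0 < s := hg.trans_le hgs
    obtain ⟨h11, -, -, h22⟩ := hA.orthonormal_blocks
    have hEs : ‖E‖ ≤ s / 10 := by linarith
    have hε : ‖U₂ᴴ * E * U₁‖ ≤ ‖E‖ := SchurPerturbation.norm_compression_le h22 h11 E
    obtain ⟨Y, hYn, hY⟩ := SchurPerturbation.exists_riccati_solution T₁₁ (U₁ᴴ * E * U₁) T₂₂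
      (U₂ᴴ * E * U₂) (U₂ᴴ * E * U₁) (T₁₂ + U₁ᴴ * E * U₂) hs
      (SchurPerturbation.sep_specNorm_mul_le T₁₁ T₂₂) (hε.trans hEs)
      ((SchurPerturbation.norm_compression_le h22 h22 E).trans hEs)
      ((SchurPerturbation.norm_compression_le h11 h11 E).trans hEs)
      (by grw [norm_add_le, SchurPerturbation.norm_compression_le h11 h22, hE, hT]; linarith)
    refine ⟨Y, hortho Y,
      SchurPerturbation.range_perturbedBasis_mem_invtSubmodule (hA.mul_graph E hY), hmin Y ?_⟩
    have hV := hA.twoInfNorm_mul_le E hg (min_le_right _ _) hE hT hYn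
      (by rw [div_le_iff₀ hs]; linarith) hY
    have hYE : ‖Y‖ ≤ 2 * (‖E‖ / s) := by
      rw [← mul_div_assoc]; exact hYn.trans (by gcongr)
    have hsq : ‖Y‖ ^ 2 / 2 ≤ 8 * (‖E‖ / s) ^ 2 := by
      nlinarith [pow_le_pow_left₀ (norm_nonneg Y) hYE 2, sq_nonneg (‖E‖ / s)]
    have hlast : 2 * (SchurPerturbation.twoInfNorm (U₂ * U₂ᴴ * E * U₂ * U₂ᴴ) *
        (2 * ‖U₂ᴴ * E * U₁‖ / s) / g) =
        4 * (SchurPerturbation.twoInfNorm (U₂ * U₂ᴴ * E * U₂ * U₂ᴴ) * ‖U₂ᴴ * E * U₁‖ /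
          (g * s)) := by
      field_simp; ring
    rw [hlast] at hV
    have h8 := mul_le_mul_of_nonneg_left hsq hN1
    linarith [SchurPerturbation.twoInfNorm_perturbedBasis_sub_le U₁ U₂ Y]
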